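/- For integers $n,j\ge 0$ let $S_3(n,j)$ be the $3$-associated Stirling number of the second kind, that is, the number of partitions of a set of $n$ elements into $j$ blocks, each with at least $3$ elements (with $S_3(0,0)=1$). Then $$ n!\asymp \sqrt{2\pi n}\,e^{-n}n^n\Big(\sum_{k\ge 0}\frac{a_k}{n^k}\Big)\qquad (n\to\infty), $$ where the coefficients are uniquely determined and given, for every $k\ge 0$, by $$ a_k=\sum_{j=0}^{2k}(-1)^j\,\frac{S_3\big(2(j+k),j\big)}{2^{j+k}\,(j+k)!}. $$ Here the expansion is understood in the asymptotic sense: for every integer $N\ge 0$, $$ n!=\sqrt{2\pi n}\,e^{-n}n^n\Big(\sum_{k=0}^{N}\frac{a_k}{n^k}+R_{N+1}(n)\Big)\quad(n\ge 1),\qquad R_{N+1}(n)=O\big(n^{-(N+1)}\big)\ \text{ as } n\to\infty. $$ -/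

import Mathlib

open Filter Asymptotics
open scoped Nat

/-- The `r`-associated Stirling number of the second kind `S_r(n, k)`: the number of partitions of
a set of `n` elements into `k` blocks, each with at least `r` elements. (The blocks of a
`Finpartition` are nonempty; the empty set has exactly one partition, with no blocks, so that
`S_r(0, 0) = 1`.) -/
def assocStirlingSecond (r n k : ℕ) : ℕ :=
  ((Finset.univ : Finset (Finpartition (Finset.univ : Finset (Fin n)))).filter
    (fun P => P.parts.card = k ∧ ∀ b ∈ P.parts, r ≤ b.card)).card

/-- `n! ≍ √(2πn) e⁻ⁿ nⁿ (∑_{k ≥ 0} a_k / n^k)` as an asymptotic expansion: for every `N ≥ 0`,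
`n! = √(2πn) e⁻ⁿ nⁿ (∑_{k = 0}^{N} a_k / n^k + R_{N+1}(n))` for all `n ≥ 1`, where
`R_{N+1}(n) = O(1 / n^{N+1})` as `n → ∞`. -/
def IsFactorialAsymptoticExpansion (a : ℕ → ℝ) : Prop :=
  ∀ N : ℕ, ∃ R : ℕ → ℝ,
    (∀ n : ℕ, 1 ≤ n →
      (n ! : ℝ) = Real.sqrt (2 * Real.pi * n) * Real.exp (-(n : ℝ)) * (n : ℝ) ^ n *
        ((∑ k ∈ Finset.range (N + 1), 1 / (n : ℝ) ^ k * a k) + R n)) ∧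
    R =O[atTop] (fun n : ℕ => 1 / (n : ℝ) ^ (N + 1))

/-! Write n! = n Γ(n) and substitute t = n e^{εx} with ε = 1/√n: up to the factor √n e^{-n} n^n, n!
is the integral of exp(-(e^{εx}-1-εx)/ε²) (`integral_laplaceIntegrand`). The exponent is -x²/2 - x²
g(εx), where g(u) = (e^u-1-u-u²/2)/u² is `expRemainder`.

In powers of u, exp(-x² g(u)) has coefficients Σ_j (-x²)^j/j! [u^m] g^j, and [u^m] g^j / j! =
S_3(m+2j, j)/(m+2j)!, because u² g(u) is the exponential generating function of a single block of
size at least 3 (`coeff_expRemainder_pow`). Against the Gaussian, odd m contribute nothing and m =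
2k contributes √(2π) a_k ε^{2k} (`integral_laplaceApprox`). Keeping only m < M costs at most ε^M
times a fixed integrable function (`abs_laplaceIntegrand_sub_laplaceApprox_le`).

Uniqueness compares two expansions at the first coefficient where they could differ. -/

/-! ### Associated Stirling numbers: recursion and generating function -/

namespace Finpartition

variable {α : Type*} [DecidableEq α] {s B : Finset α}

lemma parts_avoid_of_mem (P : Finpartition s) (hB : B ∈ P.parts) :
    (P.avoid B).parts = P.parts.erase B := by
  ext c
  rw [mem_avoid, Finset.mem_erase]
  have key : ∀ d ∈ P.parts, d ≠ B → d \ B = d := fun d hd hne =>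
    Finset.sdiff_eq_self_of_disjoint (P.disjoint hd hB hne)
  constructor
  · rintro ⟨d, hd, hdB, rfl⟩
    have hne : d ≠ B := fun h => hdB h.le
    rw [key d hd hne]
    exact ⟨hne, hd⟩
  · rintro ⟨hne, hc⟩
    refine ⟨c, hc, fun hle => ?_, key c hc hne⟩
    have h1 := key c hc hne
    rw [Finset.sdiff_eq_empty_iff_subset.2 hle] at h1
    exact P.ne_empty hc h1.symm

/-- The number of partitions of `s` into `k` blocks, each with at least `r` elements. -/
def cardBlocks (r k : ℕ) (s : Finset α) : ℕ :=
  ((Finset.univ : Finset (Finpartition s)).filter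
    (fun P => P.parts.card = k ∧ ∀ b ∈ P.parts, r ≤ b.card)).card

lemma cardBlocks_zero (r : ℕ) (s : Finset α) :
    cardBlocks r 0 s = if s.card = 0 then 1 else 0 := by
  unfold cardBlocks
  split_ifs with h
  · obtain rfl := Finset.card_eq_zero.1 h
    rw [Finset.card_eq_one]
    refine ⟨Finpartition.empty _, ?_⟩
    ext P
    simp only [Finset.mem_filter, Finset.mem_univ, true_and, Finset.card_eq_zero,
      Finset.mem_singleton]
    constructor
    · rintro ⟨h, -⟩
      exact Finpartition.ext (h.trans rfl)
    · rintro rfl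
      exact ⟨rfl, fun b hb => absurd hb (Finset.notMem_empty b)⟩
  · rw [Finset.card_eq_zero, Finset.filter_eq_empty_iff]
    rintro P - ⟨h0, -⟩
    rw [Finset.card_eq_zero, parts_eq_empty_iff] at h0
    exact h (by simpa using h0)

lemma cardBlocks_succ_empty (r k : ℕ) : cardBlocks r (k + 1) (∅ : Finset α) = 0 := by
  unfold cardBlocks
  rw [Finset.card_eq_zero, Finset.filter_eq_empty_iff]
  rintro P - ⟨h0, -⟩
  have : P.parts = ∅ := P.parts_eq_empty_iff.2 rfl
  simp [this] at h0

/-- Removing a block `B` is a bijection from the partitions of `s` with the block `B` to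
the partitions of `s \ B`. -/
lemma card_filter_mem_parts (r k : ℕ) (hBs : B ⊆ s) (hB : B.Nonempty) (hr : r ≤ B.card) :
    ((Finset.univ : Finset (Finpartition s)).filter
      (fun P => (P.parts.card = k + 1 ∧ ∀ b ∈ P.parts, r ≤ b.card) ∧ B ∈ P.parts)).card =
      cardBlocks r k (s \ B) := by
  unfold cardBlocks
  have hBbot : B ≠ ⊥ := hB.ne_empty
  have hdis : Disjoint (s \ B) B := Finset.sdiff_disjoint
  have hsup : s \ B ⊔ B = s := Finset.sdiff_union_of_subset hBs
  have hnot : ∀ Q : Finpartition (s \ B), B ∉ Q.parts := fun Q hQ => by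
    obtain ⟨x, hx⟩ := hB
    exact (Finset.mem_sdiff.1 (Q.subset hQ hx)).2 hx
  have hext : ∀ Q : Finpartition (s \ B),
      (Q.extend hBbot hdis hsup).parts = insert B Q.parts := fun Q => rfl
  refine Finset.card_nbij' (fun P => P.avoid B) (fun Q => Q.extend hBbot hdis hsup) ?_ ?_ ?_ ?_
  · intro P hP
    simp only [Finset.coe_filter, Finset.mem_univ, true_and, Set.mem_ofPred_eq] at hP ⊢
    obtain ⟨⟨h1, h2⟩, h3⟩ := hP
    rw [parts_avoid_of_mem P h3, Finset.card_erase_of_mem h3, h1]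
    exact ⟨rfl, fun b hb => h2 b (Finset.mem_of_mem_erase hb)⟩
  · intro Q hQ
    simp only [Finset.coe_filter, Finset.mem_univ, true_and, Set.mem_ofPred_eq] at hQ ⊢
    obtain ⟨h1, h2⟩ := hQ
    rw [hext, Finset.card_insert_of_notMem (hnot Q), h1]
    refine ⟨⟨rfl, fun b hb => ?_⟩, Finset.mem_insert_self _ _⟩
    rcases Finset.mem_insert.1 hb with rfl | hb
    exacts [hr, h2 b hb]
  · intro P hP
    simp only [Finset.coe_filter, Finset.mem_univ, true_and, Set.mem_ofPred_eq] at hP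
    apply Finpartition.ext
    rw [hext, parts_avoid_of_mem P hP.2, Finset.insert_erase hP.2]
  · intro Q _
    apply Finpartition.ext
    rw [parts_avoid_of_mem _ (by rw [hext]; exact Finset.mem_insert_self _ _), hext,
      Finset.erase_insert (hnot Q)]

/-- Partitions are sorted by the block of `a`: `C` is that block without `a`, and the other blocks
partition `s \ C`. -/
lemma cardBlocks_insert (r k : ℕ) {a : α} (ha : a ∉ s) :
    cardBlocks r (k + 1) (insert a s) =
      ∑ C ∈ s.powerset, if r ≤ C.card + 1 then cardBlocks r k (s \ C) else 0 := by
  have hmem : a ∈ insert a s := Finset.mem_insert_self a s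
  have hmaps : ∀ P ∈ (Finset.univ : Finset (Finpartition (insert a s))).filter
      (fun P => P.parts.card = k + 1 ∧ ∀ b ∈ P.parts, r ≤ b.card),
      (P.part a).erase a ∈ s.powerset := fun P _ => by
    rw [Finset.mem_powerset, ← Finset.subset_insert_iff]
    exact P.part_subset a
  rw [cardBlocks, Finset.card_eq_sum_card_fiberwise hmaps]
  refine Finset.sum_congr rfl fun C hC => ?_
  have hCs := Finset.mem_powerset.1 hC
  have haC : a ∉ C := fun h => ha (hCs h)
  have hiff : ∀ P : Finpartition (insert a s),
      (P.part a).erase a = C ↔ insert a C ∈ P.parts := fun P => by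
    constructor
    · rintro rfl
      rw [Finset.insert_erase (P.mem_part_self.2 hmem)]
      exact P.part_mem.2 hmem
    · intro h
      rw [P.part_eq_of_mem h (Finset.mem_insert_self a C), Finset.erase_insert haC]
  have hsd : insert a s \ insert a C = s \ C := by
    ext x
    simp only [Finset.mem_sdiff, Finset.mem_insert, not_or]
    constructor
    · rintro ⟨rfl | h, h2, h3⟩
      exacts [absurd rfl h2, ⟨h, h3⟩]
    · rintro ⟨h1, h2⟩
      exact ⟨Or.inr h1, fun h => ha (h ▸ h1), h2⟩
  rw [Finset.filter_filter]
  simp only [hiff]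
  split_ifs with hr
  · rw [card_filter_mem_parts r k (Finset.insert_subset_insert a hCs) (Finset.insert_nonempty a C)
      (by rwa [Finset.card_insert_of_notMem haC]), hsd]
  · rw [Finset.card_eq_zero, Finset.filter_eq_empty_iff]
    rintro P - ⟨⟨-, h⟩, hP⟩
    have := h _ hP
    rw [Finset.card_insert_of_notMem haC] at this
    exact hr this

lemma assocStirlingSecond_eq_cardBlocks_univ (r n k : ℕ) :
    assocStirlingSecond r n k = cardBlocks r k (Finset.univ : Finset (Fin n)) := by
  unfold assocStirlingSecond cardBlocks
  congr

/-- The number of partitions with prescribed block number and sizes depends only on the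
cardinality. -/
lemma cardBlocks_eq (r k : ℕ) {n : ℕ} (s : Finset (Fin n)) :
    cardBlocks r k s = assocStirlingSecond r s.card k := by
  -- `f` must not depend on the ambient `n`: the final comparison is between `s` in `Fin n` and the
  -- whole of `Fin s.card`.
  have key : ∃ f : ℕ → ℕ, ∀ (n : ℕ) (t : Finset (Fin n)), cardBlocks r k t = f t.card := by
    induction k with
    | zero => exact ⟨fun n => if n = 0 then 1 else 0, fun n t => cardBlocks_zero r t⟩
    | succ k ih =>
      obtain ⟨f, hf⟩ := ih
      refine ⟨fun m => if m = 0 then 0 else ∑ i ∈ Finset.range m, (m - 1).choose i *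
              (if r ≤ i + 1 then f (m - 1 - i) else 0), fun n s => ?_⟩
      rcases s.eq_empty_or_nonempty with rfl | ⟨a, ha⟩
      · simp [cardBlocks_succ_empty]
      · obtain ⟨t, hat, rfl⟩ : ∃ t, a ∉ t ∧ insert a t = s :=
          ⟨s.erase a, Finset.notMem_erase a s, Finset.insert_erase ha⟩
        beta_reduce
        rw [if_neg (Finset.card_ne_zero_of_mem ha), cardBlocks_insert r k hat,
          Finset.card_insert_of_notMem hat, Nat.add_sub_cancel]
        simp_rw [← smul_eq_mul]
        rw [← Finset.sum_powerset_apply_card (fun i => if r ≤ i + 1 then f (t.card - i) else 0)]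
        refine Finset.sum_congr rfl fun C hC => ?_
        rw [hf, Finset.card_sdiff_of_subset (Finset.mem_powerset.1 hC)]
  obtain ⟨f, hf⟩ := key
  rw [hf, assocStirlingSecond_eq_cardBlocks_univ, hf, Finset.card_univ, Fintype.card_fin]

end Finpartition

open Finpartition

lemma assocStirlingSecond_zero (r n : ℕ) :
    assocStirlingSecond r n 0 = if n = 0 then 1 else 0 := by
  rw [assocStirlingSecond_eq_cardBlocks_univ, cardBlocks_zero, Finset.card_univ, Fintype.card_fin]

lemma assocStirlingSecond_zero_succ (r k : ℕ) : assocStirlingSecond r 0 (k + 1) = 0 := by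
  have := cardBlocks_eq r (k + 1) (∅ : Finset (Fin 0))
  rw [cardBlocks_succ_empty] at this
  simpa using this.symm

/-- Recursion on the size of the block of a distinguished element. -/
lemma assocStirlingSecond_succ_succ (r n k : ℕ) :
    assocStirlingSecond r (n + 1) (k + 1) = ∑ i ∈ Finset.range (n + 1),
      n.choose i * if r ≤ i + 1 then assocStirlingSecond r (n - i) k else 0 := by
  obtain ⟨t, h0, ht⟩ : ∃ t : Finset (Fin (n + 1)), 0 ∉ t ∧ insert 0 t = Finset.univ :=
    ⟨Finset.univ.erase 0, Finset.notMem_erase _ _, Finset.insert_erase (Finset.mem_univ _)⟩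
  have hcard : t.card = n := by
    have := congrArg Finset.card ht
    rw [Finset.card_insert_of_notMem h0, Finset.card_univ, Fintype.card_fin] at this
    omega
  rw [assocStirlingSecond_eq_cardBlocks_univ, ← ht, cardBlocks_insert r k h0]
  simp_rw [← smul_eq_mul]
  have h := Finset.sum_powerset_apply_card (x := t)
    (fun i => if r ≤ i + 1 then assocStirlingSecond r (n - i) k else 0)
  rw [hcard] at h
  rw [← h]
  refine Finset.sum_congr rfl fun C hC => ?_
  have hsd := Finset.card_sdiff_of_subset (Finset.mem_powerset.1 hC)
  rw [hcard] at hsd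
  rw [cardBlocks_eq, hsd]

/-- The exponential generating function of the one-block partitions with blocks of size at least
`r`. -/
noncomputable def expTail (r : ℕ) : PowerSeries ℝ :=
  PowerSeries.mk fun n => if r ≤ n then ((n ! : ℝ))⁻¹ else 0

open PowerSeries in
/-- The exponential generating function of the associated Stirling numbers with `k` blocks. -/
lemma mk_assocStirlingSecond {r : ℕ} (hr : 1 ≤ r) (k : ℕ) :
    PowerSeries.mk (fun n => (assocStirlingSecond r n k : ℝ) / (n ! : ℝ)) =
      C ((k ! : ℝ)⁻¹) * expTail r ^ k := by
  induction k with
  | zero =>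
    ext n
    rw [coeff_mk, assocStirlingSecond_zero]
    rcases n with _ | n <;> simp [coeff_one]
  | succ k ih =>
    -- Both sides have zero constant term (on the right because `1 ≤ r`) and satisfy F_{k+1}' = E'
    -- F_k with E = `expTail r`; on the left this is the recursion.
    refine derivative.ext ?_ ?_
    · have hE : d⁄dX ℝ (expTail r) =
          PowerSeries.mk fun n => if r ≤ n + 1 then ((n ! : ℝ))⁻¹ else 0 := by
        ext n
        rw [coeff_derivative, expTail, coeff_mk, coeff_mk]
        split_ifs
        · rw [Nat.factorial_succ]
          push_cast
          field_simp
        · simp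
      have hrhs : d⁄dX ℝ (C (((k + 1)! : ℝ)⁻¹) * expTail r ^ (k + 1)) =
          d⁄dX ℝ (expTail r) * (C ((k ! : ℝ)⁻¹) * expTail r ^ k) := by
        have hC : C (((k + 1)! : ℝ)⁻¹) * ((k + 1 : ℕ) : PowerSeries ℝ) = C ((k ! : ℝ)⁻¹) := by
          rw [← map_natCast (C (R := ℝ)), ← map_mul]
          congr 1
          rw [Nat.factorial_succ]
          push_cast
          field_simp
        rw [Derivation.leibniz, derivative_C, derivative_pow, smul_zero, add_zero, smul_eq_mul,
          ← hC, Nat.add_sub_cancel]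
        ring
      rw [hrhs, ← ih, hE]
      ext n
      rw [coeff_derivative, coeff_mk, coeff_mul, assocStirlingSecond_succ_succ,
        Finset.Nat.sum_antidiagonal_eq_sum_range_succ_mk, Nat.cast_sum, Finset.sum_div,
        Finset.sum_mul]
      refine Finset.sum_congr rfl fun i hi => ?_
      have hi' : i ≤ n := Nat.lt_succ_iff.1 (Finset.mem_range.1 hi)
      rw [coeff_mk, coeff_mk]
      split_ifs
      · rw [Nat.cast_mul, Nat.cast_choose ℝ hi', Nat.factorial_succ]
        push_cast
        field_simp
      · simp
    · have h0 : constantCoeff (expTail r) = 0 := by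
        rw [← coeff_zero_eq_constantCoeff_apply, expTail, coeff_mk, if_neg (by omega)]
      rw [← coeff_zero_eq_constantCoeff_apply, coeff_mk, assocStirlingSecond_zero_succ]
      simp [h0]

/-! ### Exponentials of power series with nonnegative coefficients -/

open PowerSeries

/-- A power series with nonnegative coefficients that converges at `1`, evaluated at `u`. -/
noncomputable def PowerSeries.tsumEval (f : PowerSeries ℝ) (u : ℝ) : ℝ :=
  ∑' m, coeff m f * u ^ m

section
variable {f : PowerSeries ℝ} {u : ℝ}

lemma summable_norm_coeff_mul_pow (h0 : ∀ m, 0 ≤ coeff m f) (hf : Summable fun m => coeff m f)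
    (hu : |u| ≤ 1) : Summable fun m => ‖coeff m f * u ^ m‖ := by
  refine Summable.of_nonneg_of_le (fun _ => norm_nonneg _) (fun m => ?_) hf
  rw [norm_mul, norm_pow, Real.norm_eq_abs, Real.norm_eq_abs, abs_of_nonneg (h0 m)]
  exact mul_le_of_le_one_right (h0 m) (pow_le_one₀ (abs_nonneg _) hu)

lemma summable_norm_coeff_pow_mul_pow (h : Summable fun m => ‖coeff m f * u ^ m‖) (j : ℕ) :
    (Summable fun m => ‖coeff m (f ^ j) * u ^ m‖) ∧
      ∑' m, coeff m (f ^ j) * u ^ m = f.tsumEval u ^ j := by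
  induction j with
  | zero =>
    have hz : ∀ m ≠ 0, coeff m (f ^ 0) * u ^ m = 0 := fun m hm => by
      rw [pow_zero, coeff_one, if_neg hm, zero_mul]
    refine ⟨summable_of_ne_finset_zero (s := {0}) fun m hm => ?_, ?_⟩
    · rw [hz m (by simpa using hm), norm_zero]
    · rw [tsum_eq_single 0 hz]
      simp
  | succ j ih =>
    set F : ℕ → ℝ := fun m => coeff m (f ^ j) * u ^ m with hF
    set G : ℕ → ℝ := fun m => coeff m f * u ^ m with hG
    have hmul : ∀ m, coeff m (f ^ (j + 1)) * u ^ m = ∑ p ∈ Finset.HasAntidiagonal.antidiagonal m,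
        F p.1 * G p.2 := fun m => by
      rw [pow_succ, coeff_mul, Finset.sum_mul]
      refine Finset.sum_congr rfl fun p hp => ?_
      rw [← Finset.HasAntidiagonal.mem_antidiagonal.1 hp, pow_add]
      simp only [hF, hG]
      ring
    simp_rw [hmul]
    refine ⟨summable_norm_sum_mul_antidiagonal_of_summable_norm (f := F) (g := G) ih.1 h, ?_⟩
    rw [← tsum_mul_tsum_eq_tsum_sum_antidiagonal_of_summable_norm (f := F) (g := G) ih.1 h, ih.2,
      pow_succ]
    rfl

lemma coeff_pow_nonneg (h0 : ∀ m, 0 ≤ coeff m f) (j m : ℕ) : 0 ≤ coeff m (f ^ j) := by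
  induction j generalizing m with
  | zero => rw [pow_zero, coeff_one]; split_ifs <;> norm_num
  | succ j ih =>
    rw [pow_succ, coeff_mul]
    exact Finset.sum_nonneg fun p _ => mul_nonneg (ih _) (h0 _)

lemma coeff_pow_eq_zero_of_lt (hc : constantCoeff f = 0) {j m : ℕ} (hm : m < j) :
    coeff m (f ^ j) = 0 :=
  X_pow_dvd_iff.1 (pow_dvd_pow_of_dvd (X_dvd_iff.2 hc) j) m hm

/-- The coefficients of `exp (s f)` for a power series `f` without constant term. -/
noncomputable def PowerSeries.expCoeff (f : PowerSeries ℝ) (s : ℝ) (m : ℕ) : ℝ :=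
  ∑ j ∈ Finset.range (m + 1), s ^ j / (j ! : ℝ) * coeff m (f ^ j)

lemma abs_expCoeff_le (h0 : ∀ m, 0 ≤ coeff m f) (s : ℝ) (m : ℕ) :
    |f.expCoeff s m| ≤ f.expCoeff |s| m := by
  refine (Finset.abs_sum_le_sum_abs _ _).trans_eq (Finset.sum_congr rfl fun j _ => ?_)
  rw [abs_mul, abs_div, abs_pow, abs_of_nonneg (coeff_pow_nonneg h0 j m), Nat.abs_cast]

/-- Expand the exponential and exchange the sums over j and m. The double series converges
absolutely, being dominated by the exponential series at |s| f(|u|). For fixed m only j ≤ m survive,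
since f^j starts in degree j. -/
lemma hasSum_expCoeff (h0 : ∀ m, 0 ≤ coeff m f) (hf : Summable fun m => coeff m f)
    (hc : constantCoeff f = 0) (hu : |u| ≤ 1) (s : ℝ) :
    HasSum (fun m => f.expCoeff s m * u ^ m) (Real.exp (s * f.tsumEval u)) := by
  have h1 := summable_norm_coeff_mul_pow h0 hf hu
  have h1' : Summable fun m => ‖coeff m f * |u| ^ m‖ :=
    summable_norm_coeff_mul_pow h0 hf (by rwa [abs_abs])
  set a : ℕ → ℕ → ℝ := fun j m => s ^ j / (j ! : ℝ) * (coeff m (f ^ j) * u ^ m) with ha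
  have hnorm : ∀ j m, ‖a j m‖ = |s| ^ j / (j ! : ℝ) * (coeff m (f ^ j) * |u| ^ m) := fun j m => by
    simp only [ha, norm_mul, norm_div, norm_pow, Real.norm_eq_abs, Nat.abs_cast,
      abs_of_nonneg (coeff_pow_nonneg h0 j m)]
  have hsum : Summable (fun p : ℕ × ℕ => a p.1 p.2) := by
    refine Summable.of_norm ((summable_prod_of_nonneg fun _ => norm_nonneg _).2 ⟨fun j => ?_, ?_⟩)
    · simp_rw [hnorm]
      exact (Summable.of_norm (summable_norm_coeff_pow_mul_pow h1' j).1).mul_left _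
    · simp_rw [hnorm, tsum_mul_left, (summable_norm_coeff_pow_mul_pow h1' _).2]
      refine (Real.summable_pow_div_factorial (|s| * f.tsumEval |u|)).congr fun j => ?_
      rw [mul_pow]
      ring
  have hexp : Real.exp (s * f.tsumEval u) = ∑' j, ∑' m, a j m := by
    rw [Real.exp_eq_exp_ℝ, NormedSpace.exp_eq_tsum_div]
    refine tsum_congr fun j => ?_
    rw [tsum_mul_left, (summable_norm_coeff_pow_mul_pow h1 _).2, mul_pow]
    ring
  have hcol : ∀ m, ∑' j, a j m = f.expCoeff s m * u ^ m := fun m => by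
    rw [tsum_eq_sum (s := Finset.range (m + 1)) fun j hj => ?_, expCoeff, Finset.sum_mul]
    · exact Finset.sum_congr rfl fun j _ => by simp only [ha]; ring
    · simp only [ha]
      rw [coeff_pow_eq_zero_of_lt hc (by simpa using hj), zero_mul, mul_zero]
  rw [hexp, ← Summable.tsum_comm (f := a) hsum, ← tsum_congr (fun m => (hcol m).symm)]
  simp_rw [← hcol]
  exact hsum.prod_symm.prod.hasSum

lemma hasSum_expCoeff_one (h0 : ∀ m, 0 ≤ coeff m f) (hf : Summable fun m => coeff m f)
    (hc : constantCoeff f = 0) (s : ℝ) :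
    HasSum (fun m => f.expCoeff s m) (Real.exp (s * f.tsumEval 1)) := by
  simpa using hasSum_expCoeff (u := 1) h0 hf hc (by simp) s

/-- In the tail |u|^m ≤ |u|^M, and the absolute coefficients are majorized by those for |s|, whose
total is exp(|s| f(1)). -/
lemma abs_exp_sub_sum_expCoeff_le (h0 : ∀ m, 0 ≤ coeff m f) (hf : Summable fun m => coeff m f)
    (hc : constantCoeff f = 0) (hu : |u| ≤ 1) (s : ℝ) (M : ℕ) :
    |Real.exp (s * f.tsumEval u) - ∑ m ∈ Finset.range M, f.expCoeff s m * u ^ m| ≤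
      |u| ^ M * Real.exp (|s| * f.tsumEval 1) := by
  have h1 := hasSum_expCoeff h0 hf hc hu s
  have h2 := hasSum_expCoeff_one h0 hf hc |s|
  rw [← h1.tsum_eq, ← h2.tsum_eq, ← h1.summable.sum_add_tsum_nat_add M, add_sub_cancel_left]
  have h3 : ∀ m, ‖f.expCoeff s (m + M) * u ^ (m + M)‖ ≤ |u| ^ M * f.expCoeff |s| (m + M) := by
    intro m
    rw [norm_mul, norm_pow, Real.norm_eq_abs, Real.norm_eq_abs, pow_add, mul_comm]
    refine mul_le_mul ?_ (abs_expCoeff_le h0 s _) (abs_nonneg _) (by positivity)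
    exact mul_le_of_le_one_left (by positivity) (pow_le_one₀ (abs_nonneg _) hu)
  have h4 : Summable fun m => |u| ^ M * f.expCoeff |s| (m + M) :=
    ((summable_nat_add_iff M).2 h2.summable).mul_left _
  refine (tsum_of_norm_bounded h4.hasSum h3).trans ?_
  rw [tsum_mul_left]
  refine mul_le_mul_of_nonneg_left ?_ (by positivity)
  rw [← h2.summable.sum_add_tsum_nat_add M]
  exact le_add_of_nonneg_left
    (Finset.sum_nonneg fun m _ => (abs_nonneg _).trans (abs_expCoeff_le h0 s m))

/-- The same majorant for |u| ≥ 1, where the series itself may diverge: now |u|^m ≤ |u|^M for the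
terms kept. -/
lemma abs_sum_expCoeff_le (h0 : ∀ m, 0 ≤ coeff m f) (hf : Summable fun m => coeff m f)
    (hc : constantCoeff f = 0) (hu : 1 ≤ |u|) (s : ℝ) (M : ℕ) :
    |∑ m ∈ Finset.range M, f.expCoeff s m * u ^ m| ≤
      |u| ^ M * Real.exp (|s| * f.tsumEval 1) := by
  have h2 := hasSum_expCoeff_one h0 hf hc |s|
  have hnn : ∀ m, 0 ≤ f.expCoeff |s| m := fun m => (abs_nonneg _).trans (abs_expCoeff_le h0 s m)
  calc |∑ m ∈ Finset.range M, f.expCoeff s m * u ^ m|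
      ≤ ∑ m ∈ Finset.range M, |u| ^ M * f.expCoeff |s| m := by
        refine (Finset.abs_sum_le_sum_abs _ _).trans (Finset.sum_le_sum fun m hm => ?_)
        rw [abs_mul, abs_pow, mul_comm]
        exact mul_le_mul (pow_le_pow_right₀ hu (Finset.mem_range.1 hm).le) (abs_expCoeff_le h0 s m)
          (abs_nonneg _) (by positivity)
    _ ≤ _ := by
        rw [← Finset.mul_sum]
        exact mul_le_mul_of_nonneg_left (sum_le_hasSum _ (fun m _ => hnn m) h2) (by positivity)

end

/-! ### The remainder series g and its powers -/

/-- The power series of `(exp u - 1 - u - u ^ 2 / 2) / u ^ 2`. -/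
noncomputable def expRemainder : PowerSeries ℝ :=
  PowerSeries.mk fun n => if 1 ≤ n then (((n + 2)! : ℝ))⁻¹ else 0

lemma coeff_expRemainder_nonneg (m : ℕ) : 0 ≤ coeff m expRemainder := by
  rw [expRemainder, coeff_mk]
  split_ifs <;> positivity

lemma constantCoeff_expRemainder : constantCoeff expRemainder = 0 := by
  rw [← coeff_zero_eq_constantCoeff_apply, expRemainder, coeff_mk, if_neg (by omega)]

lemma hasSum_expRemainder (u : ℝ) : HasSum (fun m => coeff m expRemainder * u ^ (m + 2))
    (Real.exp u - 1 - u - u ^ 2 / 2) := by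
  have h : HasSum (fun n => u ^ n / (n ! : ℝ)) (Real.exp u) := by
    rw [Real.exp_eq_exp_ℝ]
    exact NormedSpace.expSeries_div_hasSum_exp u
  have h3 := (hasSum_nat_add_iff' 3).2 h
  rw [← hasSum_nat_add_iff' 1]
  convert h3 using 1
  · ext m
    rw [expRemainder, coeff_mk, if_pos (by omega)]
    ring_nf
  · simp [Finset.sum_range_succ, expRemainder]
    ring

lemma summable_coeff_expRemainder : Summable fun m => coeff m expRemainder := by
  simpa using (hasSum_expRemainder 1).summable

lemma tsumEval_expRemainder_one : expRemainder.tsumEval 1 = Real.exp 1 - 5 / 2 := by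
  have := (hasSum_expRemainder 1).tsum_eq
  simp only [one_pow, mul_one] at this
  simp only [tsumEval, one_pow, mul_one, this]
  ring

lemma sq_mul_tsumEval_expRemainder (u : ℝ) :
    u ^ 2 * expRemainder.tsumEval u = Real.exp u - 1 - u - u ^ 2 / 2 := by
  rw [← (hasSum_expRemainder u).tsum_eq, tsumEval, ← tsum_mul_left]
  exact tsum_congr fun m => by ring

lemma coeff_expRemainder_pow (j m : ℕ) : ((j ! : ℝ))⁻¹ * coeff m (expRemainder ^ j) =
    (assocStirlingSecond 3 (m + 2 * j) j : ℝ) / ((m + 2 * j)! : ℝ) := by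
  have h : expTail 3 = X ^ 2 * expRemainder := by
    ext n
    rw [coeff_X_pow_mul', expTail, coeff_mk]
    split_ifs with h1 h2 h2
    · obtain ⟨k, rfl⟩ := Nat.exists_eq_add_of_le' h2
      rw [expRemainder, coeff_mk, if_pos (by omega)]
      simp
    · omega
    · rw [expRemainder, coeff_mk, if_neg (by omega)]
    · rfl
  have := congrArg (coeff (m + 2 * j)) (mk_assocStirlingSecond (r := 3) (by norm_num) j)
  rw [coeff_mk, coeff_C_mul, h, mul_pow, ← pow_mul, coeff_X_pow_mul] at this
  exact this.symm

/-! ### Gaussian moments and integrability -/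

open MeasureTheory Real Set in
lemma Real.Gamma_nat_add_half_eq_factorial (p : ℕ) :
    Gamma (p + 1 / 2) = ((2 * p)! : ℝ) / (4 ^ p * (p ! : ℝ)) * √π := by
  induction p with
  | zero => rw [Nat.cast_zero, zero_add, Gamma_one_half_eq]; simp
  | succ p ih =>
    rw [Nat.cast_succ, add_right_comm, Gamma_add_one (by positivity), ih,
      show 2 * (p + 1) = 2 * p + 1 + 1 by ring, Nat.factorial_succ, Nat.factorial_succ,
      Nat.factorial_succ]
    push_cast
    field_simp
    ring

open MeasureTheory Real Set in
lemma integral_abs_pow_mul_exp_neg_mul_sq {b : ℝ} (hb : 0 < b) (q : ℕ) :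
    ∫ x : ℝ, |x| ^ q * exp (-(b * x ^ 2)) =
      b ^ (-((q : ℝ) + 1) / 2) * Gamma (((q : ℝ) + 1) / 2) := by
  have h := integral_rpow_mul_exp_neg_mul_rpow (p := 2) (q := q) (b := b) two_pos
    (neg_one_lt_zero.trans_le q.cast_nonneg) hb
  have h2 := integral_comp_abs (f := fun x => x ^ (q : ℝ) * exp (-b * x ^ (2 : ℝ)))
  rw [h] at h2
  simp only [rpow_natCast, rpow_two, sq_abs, neg_mul] at h2
  rw [h2]
  ring

open MeasureTheory Real Set in
lemma integrable_abs_pow_mul_exp_neg_mul_sq {b : ℝ} (hb : 0 < b) (q : ℕ) :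
    Integrable fun x : ℝ => |x| ^ q * exp (-(b * x ^ 2)) := by
  -- The Bochner integral of a non-integrable function is 0, so a nonzero value proves
  -- integrability.
  refine Integrable.of_integral_ne_zero ?_
  rw [integral_abs_pow_mul_exp_neg_mul_sq hb]
  have := Gamma_pos_of_pos (s := ((q : ℝ) + 1) / 2) (by positivity)
  positivity

open MeasureTheory Real Set in
lemma integrable_abs_pow_mul_exp_neg_mul_abs {b : ℝ} (hb : 0 < b) (q : ℕ) :
    Integrable fun x : ℝ => |x| ^ q * exp (-(b * |x|)) := by
  refine Integrable.of_integral_ne_zero ?_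
  have h2 := integral_comp_abs (f := fun x => x ^ ((q + 1 : ℝ) - 1) * exp (-(b * x)))
  rw [integral_rpow_mul_exp_neg_mul_Ioi (by positivity) hb] at h2
  simp only [add_sub_cancel_right, rpow_natCast] at h2
  rw [h2]
  have := Gamma_pos_of_pos (s := (q : ℝ) + 1) (by positivity)
  positivity

open MeasureTheory Real Set in
lemma integrable_pow_mul_exp_neg_sq_half (q : ℕ) :
    Integrable fun x : ℝ => x ^ q * exp (-(x ^ 2 / 2)) := by
  refine (integrable_abs_pow_mul_exp_neg_mul_sq (b := 1 / 2) (by norm_num) q).mono'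
    (by fun_prop) (Eventually.of_forall fun x => ?_)
  rw [norm_mul, norm_pow, norm_eq_abs, norm_eq_abs, abs_exp]
  apply le_of_eq
  ring_nf

open MeasureTheory Real Set in
lemma integral_pow_two_mul_mul_exp_neg_sq_half (p : ℕ) :
    ∫ x : ℝ, x ^ (2 * p) * exp (-(x ^ 2 / 2)) =
      √(2 * π) * (((2 * p)! : ℝ) / (2 ^ p * (p ! : ℝ))) := by
  have h := integral_abs_pow_mul_exp_neg_mul_sq (b := 1 / 2) (by norm_num) (2 * p)
  have h1 : ∀ x : ℝ, |x| ^ (2 * p) * exp (-(1 / 2 * x ^ 2)) = x ^ (2 * p) * exp (-(x ^ 2 / 2)) :=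
    fun x => by rw [pow_mul, sq_abs, ← pow_mul]; ring_nf
  simp_rw [h1] at h
  rw [h, show ((2 * p : ℕ) + 1 : ℝ) / 2 = p + 1 / 2 by push_cast; ring,
    Gamma_nat_add_half_eq_factorial, neg_div,
    show ((2 * p : ℕ) + 1 : ℝ) / 2 = p + 1 / 2 by push_cast; ring, one_div, inv_rpow zero_le_two,
    rpow_neg zero_le_two, inv_inv, rpow_add two_pos, rpow_natCast, ← one_div, ← sqrt_eq_rpow,
    sqrt_mul zero_le_two, show (4 : ℝ) = 2 * 2 by norm_num, mul_pow]
  field_simp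

open MeasureTheory Real Set in
lemma integral_pow_two_mul_add_one_mul_exp_neg_sq_half (p : ℕ) :
    ∫ x : ℝ, x ^ (2 * p + 1) * exp (-(x ^ 2 / 2)) = 0 := by
  have h := integral_neg_eq_self (fun x : ℝ => x ^ (2 * p + 1) * exp (-(x ^ 2 / 2))) volume
  simp only [Odd.neg_pow ⟨p, rfl⟩, neg_sq, neg_mul, integral_neg] at h
  linarith

/-! ### Laplace's method for the Gamma integral -/

/-- The integrand of the rescaled Gamma integral: `x = √n * log (t / n)` and `ε = 1 / √n`. -/
noncomputable def laplaceIntegrand (ε x : ℝ) : ℝ :=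
  Real.exp (-((Real.exp (ε * x) - 1 - ε * x) / ε ^ 2))

/-- The first `M` terms of the expansion of `laplaceIntegrand` in powers of `ε`. -/
noncomputable def laplaceApprox (M : ℕ) (ε x : ℝ) : ℝ :=
  Real.exp (-(x ^ 2 / 2)) * ∑ m ∈ Finset.range M, expRemainder.expCoeff (-x ^ 2) m * (ε * x) ^ m

lemma abs_div_four_le_exp_sub {u : ℝ} (hu : 1 ≤ |u|) : |u| / 4 ≤ Real.exp u - 1 - u := by
  rcases le_total 0 u with h | h
  · rw [abs_of_nonneg h] at hu ⊢
    nlinarith [Real.quadratic_le_exp_of_nonneg h]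
  · rw [abs_of_nonpos h] at hu ⊢
    -- Tangent line of exp at -1; the bound holds at u = -1 because 1/e > 1/4.
    have h1 := Real.add_one_le_exp (u + 1)
    rw [Real.exp_add] at h1
    have h2 := Real.exp_one_lt_d9
    have h3 := Real.exp_pos u
    nlinarith

lemma laplaceIntegrand_eq {ε : ℝ} (hε : 0 < ε) (x : ℝ) : laplaceIntegrand ε x =
    Real.exp (-(x ^ 2 / 2)) * Real.exp (-x ^ 2 * expRemainder.tsumEval (ε * x)) := by
  have h : Real.exp (ε * x) - 1 - ε * x =
      (ε * x) ^ 2 * expRemainder.tsumEval (ε * x) + (ε * x) ^ 2 / 2 := by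
    rw [sq_mul_tsumEval_expRemainder]
    ring
  rw [laplaceIntegrand, ← Real.exp_add, h]
  congr 1
  field_simp
  ring

/-- For |εx| ≤ 1 the tail bound of the series applies. For |εx| ≥ 1 the two terms are bounded
separately, each being small on its own. -/
lemma abs_laplaceIntegrand_sub_laplaceApprox_le {ε : ℝ} (hε : 0 < ε) (hε1 : ε ≤ 1) (x : ℝ)
    (M : ℕ) : |laplaceIntegrand ε x - laplaceApprox M ε x| ≤
      ε ^ M * (|x| ^ M * Real.exp (-(1 / 4 * x ^ 2)) + |x| ^ M * Real.exp (-(1 / 4 * |x|))) := by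
  have habs : |ε * x| = ε * |x| := by rw [abs_mul, abs_of_pos hε]
  have hexp : Real.exp (-(x ^ 2 / 2)) *
      (|ε * x| ^ M * Real.exp (|-x ^ 2| * expRemainder.tsumEval 1)) ≤
      ε ^ M * (|x| ^ M * Real.exp (-(1 / 4 * x ^ 2))) := by
    rw [mul_left_comm, ← Real.exp_add, habs, mul_pow, mul_assoc, tsumEval_expRemainder_one,
      abs_neg, abs_of_nonneg (sq_nonneg x)]
    gcongr
    -- g(1) = e - 5/2 < 1/4, so half of the Gaussian exponent x²/2 is left.
    nlinarith [Real.exp_one_lt_d9, sq_nonneg x]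
  have hpos : 0 ≤ ε ^ M * (|x| ^ M * Real.exp (-(1 / 4 * |x|))) := by positivity
  rw [mul_add]
  rcases le_total |ε * x| 1 with hu | hu
  · rw [laplaceIntegrand_eq hε, laplaceApprox, ← mul_sub, abs_mul, Real.abs_exp]
    refine (mul_le_mul_of_nonneg_left (abs_exp_sub_sum_expCoeff_le coeff_expRemainder_nonneg
      summable_coeff_expRemainder constantCoeff_expRemainder hu _ M) (Real.exp_pos _).le).trans ?_
    linarith [hexp]
  · refine (abs_sub _ _).trans ?_
    rw [add_comm]
    refine add_le_add ?_ ?_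
    · rw [laplaceApprox, abs_mul, Real.abs_exp]
      exact (mul_le_mul_of_nonneg_left (abs_sum_expCoeff_le coeff_expRemainder_nonneg
        summable_coeff_expRemainder constantCoeff_expRemainder hu _ M) (Real.exp_pos _).le).trans
        hexp
    · rw [← mul_assoc, ← mul_pow, ← habs, laplaceIntegrand, Real.abs_exp]
      -- The factor |εx|^M ≥ 1 comes for free; the exponent is at least |εx|/(4ε²) ≥ |x|/4 since ε ≤
      -- 1.
      refine le_trans ?_ (le_mul_of_one_le_left (Real.exp_pos _).le (one_le_pow₀ hu))
      rw [Real.exp_le_exp, neg_le_neg_iff, le_div_iff₀ (by positivity)]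
      have := abs_div_four_le_exp_sub hu
      rw [habs] at this
      refine le_trans ?_ this
      have h0 : 0 ≤ |x| := abs_nonneg x
      nlinarith [mul_nonneg h0 hε.le, mul_nonneg (mul_nonneg h0 hε.le) (sub_nonneg.2 hε1)]

open MeasureTheory Real Set in
lemma integral_laplaceIntegrand {n : ℕ} (hn : 1 ≤ n) :
    (n ! : ℝ) = √n * exp (-(n : ℝ)) * (n : ℝ) ^ n * ∫ x, laplaceIntegrand (√n)⁻¹ x := by
  have hn0 : (0 : ℝ) < n := by exact_mod_cast hn
  have hs : 0 < √(n : ℝ) := sqrt_pos.2 hn0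
  have hss : √(n : ℝ) * √n = n := mul_self_sqrt hn0.le
  set f : ℝ → ℝ := fun x => n * exp ((√n)⁻¹ * x) with hf
  have hd : ∀ x ∈ univ, HasDerivWithinAt f (n * (exp ((√n)⁻¹ * x) * (√n)⁻¹)) univ x := fun x _ => by
    have h1 : HasDerivAt (fun y : ℝ => (√n)⁻¹ * y) ((√n)⁻¹) x := by
      simpa using (hasDerivAt_id x).const_mul ((√(n : ℝ))⁻¹)
    exact (h1.exp.const_mul (n : ℝ)).hasDerivWithinAt
  have hinj : InjOn f univ := fun x _ y _ h => by
    have h1 := exp_injective (mul_left_cancel₀ hn0.ne' h)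
    exact mul_left_cancel₀ (inv_pos.2 hs).ne' h1
  have himg : f '' univ = Ioi 0 := by
    ext t
    constructor
    · rintro ⟨x, -, rfl⟩
      exact mul_pos hn0 (exp_pos _)
    · intro ht
      refine ⟨√n * log (t / n), trivial, ?_⟩
      simp only [hf]
      rw [inv_mul_cancel_left₀ hs.ne', exp_log (div_pos ht hn0)]
      field_simp
  have hΓ := integral_image_eq_integral_abs_deriv_smul MeasurableSet.univ hd hinj
    (fun t => exp (-t) * t ^ ((n : ℝ) - 1))
  rw [himg, ← Gamma_eq_integral hn0, setIntegral_univ] at hΓ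
  have hpt : ∀ x : ℝ, |n * (exp ((√n)⁻¹ * x) * (√n)⁻¹)| • (exp (-f x) * f x ^ ((n : ℝ) - 1)) =
      (√n)⁻¹ * exp (-(n : ℝ)) * (n : ℝ) ^ n * laplaceIntegrand (√n)⁻¹ x := fun x => by
    have hfpos : 0 < f x := mul_pos hn0 (exp_pos _)
    -- The Jacobian is f(x)/√n; its factor f(x) raises t^{n-1} to t^n.
    have hpow : f x * f x ^ ((n : ℝ) - 1) = (n : ℝ) ^ n * exp (n * ((√n)⁻¹ * x)) := by
      rw [rpow_sub_one hfpos.ne', mul_div_cancel₀ _ hfpos.ne', rpow_natCast, mul_pow,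
        ← exp_nat_mul]
    have hE : exp (-f x) * exp (n * ((√n)⁻¹ * x)) =
        exp (-(n : ℝ)) * laplaceIntegrand (√n)⁻¹ x := by
      rw [laplaceIntegrand, ← exp_add, ← exp_add, inv_pow, sq, hss]
      congr 1
      simp only [hf]
      field_simp
      ring
    rw [abs_of_pos (by positivity), smul_eq_mul]
    calc _ = (√n)⁻¹ * exp (-f x) * (f x * f x ^ ((n : ℝ) - 1)) := by
          simp only [hf]; ring
      _ = (√n)⁻¹ * (n : ℝ) ^ n * (exp (-f x) * exp (n * ((√n)⁻¹ * x))) := by rw [hpow]; ring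
      _ = _ := by rw [hE]; ring
  simp_rw [hpt] at hΓ
  rw [integral_const_mul] at hΓ
  have hfac : (n ! : ℝ) = n * Gamma n := by
    rw [← Gamma_nat_eq_factorial, Gamma_add_one hn0.ne']
  rw [hfac, hΓ]
  nth_rewrite 1 [← hss]
  field_simp

open MeasureTheory in
lemma integrable_laplaceIntegrand {n : ℕ} (hn : 1 ≤ n) :
    Integrable (laplaceIntegrand (√n)⁻¹) := by
  refine Integrable.of_integral_ne_zero fun h => ?_
  have := integral_laplaceIntegrand hn
  rw [h, mul_zero] at this
  exact absurd this (by positivity)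

/-- The coefficients of the asymptotic expansion of the factorial. -/
noncomputable def factorialCoeff (k : ℕ) : ℝ :=
  ∑ j ∈ Finset.range (2 * k + 1), (-1 : ℝ) ^ j * (assocStirlingSecond 3 (2 * (j + k)) j : ℝ) /
    ((2 : ℝ) ^ (j + k) * ((j + k)! : ℝ))

lemma laplaceApprox_eq (M : ℕ) (ε x : ℝ) : laplaceApprox M ε x =
    ∑ m ∈ Finset.range M, ∑ j ∈ Finset.range (m + 1), ε ^ m * ((-1) ^ j *
      ((assocStirlingSecond 3 (m + 2 * j) j : ℝ) / ((m + 2 * j)! : ℝ))) *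
        (x ^ (m + 2 * j) * Real.exp (-(x ^ 2 / 2))) := by
  rw [laplaceApprox, Finset.mul_sum]
  refine Finset.sum_congr rfl fun m _ => ?_
  rw [expCoeff, Finset.sum_mul, Finset.mul_sum]
  refine Finset.sum_congr rfl fun j _ => ?_
  rw [← coeff_expRemainder_pow, neg_pow, pow_add, pow_mul, mul_pow]
  ring

open MeasureTheory in
lemma integrable_laplaceApprox (M : ℕ) (ε : ℝ) : Integrable (laplaceApprox M ε) := by
  rw [funext (laplaceApprox_eq M ε)]
  exact integrable_finsetSum _ fun m _ => integrable_finsetSum _ fun j _ =>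
    (integrable_pow_mul_exp_neg_sq_half _).const_mul _

lemma Finset.sum_range_two_mul_eq {A : Type*} [AddCommMonoid A] (f : ℕ → A) (K : ℕ) :
    ∑ m ∈ Finset.range (2 * K), f m = ∑ k ∈ Finset.range K, (f (2 * k) + f (2 * k + 1)) := by
  induction K with
  | zero => simp
  | succ K ih =>
    rw [Finset.sum_range_succ, ← ih, Nat.mul_succ, Finset.sum_range_succ, Finset.sum_range_succ,
      add_assoc]

-- The (2p)! of the Gaussian moment with p = j + k cancels the denominator of S_3(2p, j)/(2p)!. An
-- even number of terms pairs each m = 2k with the vanishing m = 2k + 1.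
open MeasureTheory in
lemma integral_laplaceApprox (K : ℕ) (ε : ℝ) : ∫ x, laplaceApprox (2 * K) ε x =
    √(2 * Real.pi) * ∑ k ∈ Finset.range K, ε ^ (2 * k) * factorialCoeff k := by
  simp_rw [laplaceApprox_eq]
  rw [integral_finsetSum _ fun m _ => integrable_finsetSum _ fun j _ =>
    (integrable_pow_mul_exp_neg_sq_half _).const_mul _, Finset.sum_range_two_mul_eq, Finset.mul_sum]
  refine Finset.sum_congr rfl fun k _ => ?_
  rw [integral_finsetSum _ fun j _ => (integrable_pow_mul_exp_neg_sq_half _).const_mul _,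
    integral_finsetSum _ fun j _ => (integrable_pow_mul_exp_neg_sq_half _).const_mul _]
  simp_rw [integral_const_mul]
  have hodd : ∀ j, ∫ x : ℝ, x ^ (2 * k + 1 + 2 * j) * Real.exp (-(x ^ 2 / 2)) = 0 := fun j => by
    rw [show 2 * k + 1 + 2 * j = 2 * (j + k) + 1 by ring,
      integral_pow_two_mul_add_one_mul_exp_neg_sq_half]
  simp_rw [hodd, mul_zero, Finset.sum_const_zero, add_zero]
  rw [factorialCoeff, Finset.mul_sum, Finset.mul_sum]
  refine Finset.sum_congr rfl fun j _ => ?_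
  rw [show 2 * k + 2 * j = 2 * (j + k) by ring, integral_pow_two_mul_mul_exp_neg_sq_half]
  have : ((2 * (j + k))! : ℝ) ≠ 0 := by positivity
  field_simp

/-! ### Existence and uniqueness of the expansion -/

lemma stirling_factor_ne_zero {n : ℕ} (hn : 1 ≤ n) :
    √(2 * Real.pi * n) * Real.exp (-(n : ℝ)) * (n : ℝ) ^ n ≠ 0 := by
  have : (0 : ℝ) < n := by exact_mod_cast hn
  positivity

lemma isFactorialAsymptoticExpansion_iff (a : ℕ → ℝ) : IsFactorialAsymptoticExpansion a ↔
    ∀ N : ℕ, (fun n : ℕ => (n ! : ℝ) / (√(2 * Real.pi * n) * Real.exp (-(n : ℝ)) * (n : ℝ) ^ n) -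
      ∑ k ∈ Finset.range (N + 1), 1 / (n : ℝ) ^ k * a k) =O[atTop]
        fun n : ℕ => 1 / (n : ℝ) ^ (N + 1) := by
  refine forall_congr' fun N => ⟨?_, fun h => ⟨_, fun n hn => ?_, h⟩⟩
  · rintro ⟨R, hR, hO⟩
    refine hO.congr' ?_ EventuallyEq.rfl
    filter_upwards [eventually_ge_atTop 1] with n hn
    rw [hR n hn, mul_div_cancel_left₀ _ (stirling_factor_ne_zero hn)]
    ring
  · rw [add_sub_cancel, mul_div_cancel₀ _ (stirling_factor_ne_zero hn)]

open MeasureTheory in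
lemma isFactorialAsymptoticExpansion_factorialCoeff :
    IsFactorialAsymptoticExpansion factorialCoeff := by
  rw [isFactorialAsymptoticExpansion_iff]
  intro N
  -- M = 2(N + 1) is chosen so that ε^M = 1/n^{N+1}; `B` does not depend on n.
  set B : ℝ → ℝ := fun x => |x| ^ (2 * (N + 1)) * Real.exp (-(1 / 4 * x ^ 2)) +
    |x| ^ (2 * (N + 1)) * Real.exp (-(1 / 4 * |x|)) with hB
  have hBint : Integrable B := (integrable_abs_pow_mul_exp_neg_mul_sq (by norm_num) _).add
    (integrable_abs_pow_mul_exp_neg_mul_abs (by norm_num) _)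
  have h2π : 0 < √(2 * Real.pi) := by positivity
  refine IsBigO.of_bound ((√(2 * Real.pi))⁻¹ * ∫ x, B x) ?_
  filter_upwards [eventually_ge_atTop 1] with n hn
  have hn0 : (0 : ℝ) < n := by exact_mod_cast hn
  set ε : ℝ := (√n)⁻¹ with hε
  have hε0 : 0 < ε := by positivity
  have hε1 : ε ≤ 1 := inv_le_one_of_one_le₀ (Real.one_le_sqrt.2 (by exact_mod_cast hn))
  have hεpow : ∀ k, ε ^ (2 * k) = 1 / (n : ℝ) ^ k := fun k => by
    rw [pow_mul, hε, inv_pow, Real.sq_sqrt hn0.le, inv_pow, one_div]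
  have hmain : (n ! : ℝ) / (√(2 * Real.pi * n) * Real.exp (-(n : ℝ)) * (n : ℝ) ^ n) =
      (√(2 * Real.pi))⁻¹ * ∫ x, laplaceIntegrand ε x := by
    rw [integral_laplaceIntegrand hn, Real.sqrt_mul (by positivity), ← hε]
    generalize ∫ x, laplaceIntegrand ε x = I
    field_simp
  have happ : ∑ k ∈ Finset.range (N + 1), 1 / (n : ℝ) ^ k * factorialCoeff k =
      (√(2 * Real.pi))⁻¹ * ∫ x, laplaceApprox (2 * (N + 1)) ε x := by
    rw [integral_laplaceApprox, inv_mul_cancel_left₀ h2π.ne']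
    simp_rw [hεpow]
  rw [hmain, happ, ← mul_sub, ← integral_sub (integrable_laplaceIntegrand hn)
    (integrable_laplaceApprox _ _), norm_mul, Real.norm_of_nonneg (inv_pos.2 h2π).le, mul_assoc]
  refine mul_le_mul_of_nonneg_left ?_ (inv_pos.2 h2π).le
  rw [← hεpow, Real.norm_of_nonneg (pow_nonneg hε0.le _), mul_comm (integral _ _),
    ← integral_const_mul]
  exact norm_integral_le_of_norm_le (hBint.const_mul _) (Eventually.of_forall fun x =>
    abs_laplaceIntegrand_sub_laplaceApprox_le hε0 hε1 x _)

lemma IsFactorialAsymptoticExpansion.unique {a b : ℕ → ℝ} (ha : IsFactorialAsymptoticExpansion a)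
    (hb : IsFactorialAsymptoticExpansion b) (N : ℕ) : a N = b N := by
  rw [isFactorialAsymptoticExpansion_iff] at ha hb
  induction N using Nat.strong_induction_on with
  | _ N ih =>
    -- Subtracting the two expansions cancels the earlier terms; multiplying by n^N then makes the
    -- constant `a N - b N` an O(1/n), hence 0.
    have h1 : (fun n : ℕ => 1 / (n : ℝ) ^ N * (a N - b N)) =O[atTop]
        fun n : ℕ => 1 / (n : ℝ) ^ (N + 1) := by
      refine ((hb N).sub (ha N)).congr_left fun n => ?_
      rw [sub_sub_sub_cancel_left, ← Finset.sum_sub_distrib, Finset.sum_range_succ,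
        Finset.sum_eq_zero fun k hk => ?_, zero_add, mul_sub]
      rw [ih k (Finset.mem_range.1 hk), sub_self]
    have h2 : (fun _ : ℕ => a N - b N) =O[atTop] fun n : ℕ => 1 / (n : ℝ) := by
      refine ((isBigO_refl (fun n : ℕ => (n : ℝ) ^ N) atTop).mul h1).congr' ?_ ?_ <;>
        filter_upwards [eventually_ge_atTop 1] with n hn <;>
        have hn0 : (n : ℝ) ≠ 0 := by positivity
      · field_simp
      · rw [pow_succ]
        field_simp
    have h3 := h2.trans_tendsto tendsto_one_div_atTop_nhds_zero_nat
    exact sub_eq_zero.1 (tendsto_nhds_unique tendsto_const_nhds h3)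

theorem theorem2 (a : ℕ → ℝ) :
    IsFactorialAsymptoticExpansion a ↔
      ∀ k : ℕ, a k = ∑ j ∈ Finset.range (2 * k + 1),
        (-1 : ℝ) ^ j * (assocStirlingSecond 3 (2 * (j + k)) j : ℝ) /
          ((2 : ℝ) ^ (j + k) * ((j + k)! : ℝ)) := by
  refine ⟨fun h k => h.unique isFactorialAsymptoticExpansion_factorialCoeff k, fun h => ?_⟩
  rw [show a = factorialCoeff from funext h]
  exact isFactorialAsymptoticExpansion_factorialCoeff
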